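/- Let $d,K\ge 1$ be integers, let $\Theta\subseteq\mathbb R^{d}$ be a measurable set of positive Lebesgue measure, and let $\mathcal P$ be the set of probability density functions (pdfs) on $\Theta$ with respect to Lebesgue measure, two pdfs being identified if they are equal almost everywhere. All equations and inequalities between pdfs are meant almost everywhere. An event is a measurable set $A\subseteq\Theta$. A pooling function is a map $g:\mathcal P^K\to\mathcal P$; for $q_1,\dots,q_K\in\mathcal P$ write $q=g[q_1,\dots,q_K]$, $Q_k(A)=\int_A q_k\,d\theta$ and $Q(A)=\int_A q\,d\theta$. The tuple $(q_1,\dots,q_K)$ is positive if $q_k>0$ on $\Theta$ for all $k$. For measurable $\ell:\Theta\to[0,\infty)$ and a pdf $p$ with $0<\int_\Theta \ell p\,d\theta<\infty$ put $p^{(\ell)}=\ell p/\int_\Theta \ell p\,d\theta$. The map $g$ is a dictatorship if there is a fixed $k$ with $g[q_1,\dots,q_K]=q_k$ for all $(q_1,\dots,q_K)\in\mathcal P^K$. Consider the following axioms for $g$; unless otherwise said, each is required for all $(q_1,\dots,q_K)\in\mathcal P^K$. - Zero preservation: for every event $A$, if $Q_k(A)=0$ for all $k$, then $Q(A)=0$.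 - Unanimity preservation: if $q_1=\dots=q_K=q_0$, then $q=q_0$. - SSFP (strong setwise function property): there is $h:[0,1]^K\to[0,1]$, the same for all $(q_1,\dots,q_K)$ and all events $A$, with $Q(A)=h(Q_1(A),\dots,Q_K(A))$. - WSFP (weak setwise function property): for every event $A$ there is $h_A:[0,1]^K\to[0,1]$ such that $Q(A)=h_A(Q_1(A),\dots,Q_K(A))$ for all $(q_1,\dots,q_K)$. - Likelihood principle: there is $h:[0,\infty)^K\to[0,\infty)$, the same for all $(q_1,\dots,q_K)$, with $q(\theta)=h(q_1(\theta),\dots,q_K(\theta))/\int_\Theta h(q_1(\theta'),\dots,q_K(\theta'))\,d\theta'$ for almost every $\theta$. - Weak likelihood principle: there are functions $h_\theta:[0,\infty)^K\to[0,\infty)$, $\theta\in\Theta$, the same for all $(q_1,\dots,q_K)$, with $q(\theta)=h_\theta(q_1(\theta),\dots,q_K(\theta))/\int_\Theta h_{\theta'}(q_1(\theta'),\dots,q_K(\theta'))\,d\theta'$ for almost every $\theta$. - Independence preservation: for all events $A,B$, if $Q_k(A\cap B)=Q_k(A)Q_k(B)$ for all $k$, then $Q(A\cap B)=Q(A)Q(B)$.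 - Factorization preservation: for all $d_1,d_2$ and all functions $f_1:\Theta\to\mathbb R^{d_1}$, $f_2:\Theta\to\mathbb R^{d_2}$, if for every $k$ there are real functions $a_k,b_k$ with $q_k(\theta)=a_k(f_1(\theta))\,b_k(f_2(\theta))$, then there are real functions $a,b$ with $q(\theta)=a(f_1(\theta))\,b(f_2(\theta))$. - External Bayesianity: for every measurable $\ell:\Theta\to[0,\infty)$ and every positive $(q_1,\dots,q_K)$ with $0<\int_\Theta\ell q_k\,d\theta<\infty$ for all $k$, the pdf $q^{(\ell)}$ is defined (i.e. $0<\int_\Theta \ell q\,d\theta<\infty$) and $q^{(\ell)}=g[q_1^{(\ell)},\dots,q_K^{(\ell)}]$. - Generalized Bayesianity: for all bounded, positive, measurable $\ell_1,\dots,\ell_K$ on $\Theta$ there is a measurable $h:\Theta\to[0,\infty)$, depending only on $\ell_1,\dots,\ell_K$, such that for every positive $(q_1,\dots,q_K)$ the pdf $q^{(h)}$ is defined and $q^{(h)}=g[q_1^{(\ell_1)},\dots,q_K^{(\ell_K)}]$. Theorem. Every dictatorship satisfies all ten axioms. Moreover, for a pooling function $g$ the following are equivalent: 1. $g$ is a dictatorship;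 2. $g$ satisfies the SSFP and independence preservation; 3. $g$ satisfies the WSFP and independence preservation; 4. $g$ satisfies the SSFP and external Bayesianity; 5. $g$ satisfies the WSFP and external Bayesianity; 6. $g$ satisfies the SSFP and generalized Bayesianity. -/

import Mathlib

open MeasureTheory
open scoped NNReal ENNReal

namespace OpinionPooling

/-- Probability density functions with respect to `μ`: `[0,∞)`-valued measurable functions that
integrate to one, two of them being identified when they are equal `μ`-almost everywhere. -/
def Pdf {Ω : Type*} [MeasurableSpace Ω] (μ : Measure Ω) : Type _ :=
  {q : Ω →ₘ[μ] ℝ≥0 // ∫⁻ θ, (q θ : ℝ≥0∞) ∂μ = 1}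

/-- A pdf can be evaluated at a point (through a measurable representative; only statements that
hold almost everywhere are meaningful). -/
noncomputable instance {Ω : Type*} [MeasurableSpace Ω] {μ : Measure Ω} :
    CoeFun (Pdf μ) (fun _ => Ω → ℝ≥0) :=
  ⟨fun q => q.1⟩

/-- The probability `Q(A) = ∫_A q(θ) dθ` of the event `A` under the pdf `q`. -/
noncomputable def Pdf.prob {Ω : Type*} [MeasurableSpace Ω] {μ : Measure Ω} (q : Pdf μ)
    (A : Set Ω) : unitInterval :=
  ⟨(∫⁻ θ in A, (q θ : ℝ≥0∞) ∂μ).toReal, ENNReal.toReal_nonneg, by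
    have h : ∫⁻ θ in A, (q θ : ℝ≥0∞) ∂μ ≤ 1 :=
      (setLIntegral_le_lintegral A _).trans q.2.le
    simpa using ENNReal.toReal_mono ENNReal.one_ne_top h⟩

/-- A pooling function `g : 𝒫^K → 𝒫` for `K` agents. -/
abbrev PoolingFunction {Ω : Type*} [MeasurableSpace Ω] (μ : Measure Ω) (K : ℕ) : Type _ :=
  (Fin K → Pdf μ) → Pdf μ

section Axioms

variable {Ω : Type*} [MeasurableSpace Ω] {μ : Measure Ω} {K : ℕ}

/-- `g[q₁, …, q_K] = q_k` for some fixed `k`. -/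
def IsDictatorship (g : PoolingFunction μ K) : Prop :=
  ∃ k : Fin K, ∀ q : Fin K → Pdf μ, g q = q k

def ZeroPreservation (g : PoolingFunction μ K) : Prop :=
  ∀ q : Fin K → Pdf μ, ∀ A : Set Ω, MeasurableSet A →
    (∀ k, (q k).prob A = 0) → (g q).prob A = 0

def UnanimityPreservation (g : PoolingFunction μ K) : Prop :=
  ∀ (q : Fin K → Pdf μ) (q₀ : Pdf μ), (∀ k, q k = q₀) → g q = q₀

/-- Strong setwise function property. -/
def SSFP (g : PoolingFunction μ K) : Prop :=
  ∃ h : (Fin K → unitInterval) → unitInterval,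
    ∀ q : Fin K → Pdf μ, ∀ A : Set Ω, MeasurableSet A →
      (g q).prob A = h (fun k => (q k).prob A)

/-- Weak setwise function property. -/
def WSFP (g : PoolingFunction μ K) : Prop :=
  ∀ A : Set Ω, MeasurableSet A →
    ∃ h : (Fin K → unitInterval) → unitInterval,
      ∀ q : Fin K → Pdf μ, (g q).prob A = h (fun k => (q k).prob A)

/-- The quotient is taken in `[0,∞]`; as `g q` is a pdf, the equation forces the normalizing
integral to be positive and finite. -/
def LikelihoodPrinciple (g : PoolingFunction μ K) : Prop :=
  ∃ h : (Fin K → ℝ≥0) → ℝ≥0, ∀ q : Fin K → Pdf μ, ∀ᵐ θ ∂μ,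
    (g q θ : ℝ≥0∞) = (h (fun k => q k θ) : ℝ≥0∞) / ∫⁻ θ', (h (fun k => q k θ') : ℝ≥0∞) ∂μ

/-- As the likelihood principle, with a function `h θ` that may depend on the point `θ`. -/
def WeakLikelihoodPrinciple (g : PoolingFunction μ K) : Prop :=
  ∃ h : Ω → (Fin K → ℝ≥0) → ℝ≥0, ∀ q : Fin K → Pdf μ, ∀ᵐ θ ∂μ,
    (g q θ : ℝ≥0∞) =
      (h θ (fun k => q k θ) : ℝ≥0∞) / ∫⁻ θ', (h θ' (fun k => q k θ') : ℝ≥0∞) ∂μ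

def IndependencePreservation (g : PoolingFunction μ K) : Prop :=
  ∀ q : Fin K → Pdf μ, ∀ A B : Set Ω, MeasurableSet A → MeasurableSet B →
    (∀ k, (q k).prob (A ∩ B) = (q k).prob A * (q k).prob B) →
      (g q).prob (A ∩ B) = (g q).prob A * (g q).prob B

/-- `q(θ) = a(f₁(θ)) b(f₂(θ))` for some real functions `a`, `b`. -/
def Pdf.FactorsThrough (q : Pdf μ) {d₁ d₂ : ℕ} (f₁ : Ω → EuclideanSpace ℝ (Fin d₁))
    (f₂ : Ω → EuclideanSpace ℝ (Fin d₂)) : Prop :=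
  ∃ (a : EuclideanSpace ℝ (Fin d₁) → ℝ) (b : EuclideanSpace ℝ (Fin d₂) → ℝ),
    ∀ᵐ θ ∂μ, (q θ : ℝ) = a (f₁ θ) * b (f₂ θ)

def FactorizationPreservation (g : PoolingFunction μ K) : Prop :=
  ∀ (d₁ d₂ : ℕ) (f₁ : Ω → EuclideanSpace ℝ (Fin d₁)) (f₂ : Ω → EuclideanSpace ℝ (Fin d₂))
    (q : Fin K → Pdf μ),
    (∀ k, (q k).FactorsThrough f₁ f₂) → (g q).FactorsThrough f₁ f₂

/-- Positive opinion profiles. -/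
def IsPositiveProfile (q : Fin K → Pdf μ) : Prop :=
  ∀ k, ∀ᵐ θ ∂μ, 0 < q k θ

/-- `q'` is the Bayesian update `q^(ℓ) = ℓ q / ∫ ℓ q` of `q` by the likelihood function `ℓ`; this
includes that the update is defined, i.e. `0 < ∫ ℓ q < ∞`. -/
def IsUpdate (l : Ω → ℝ≥0) (q q' : Pdf μ) : Prop :=
  0 < ∫⁻ θ, (l θ : ℝ≥0∞) * q θ ∂μ ∧ ∫⁻ θ, (l θ : ℝ≥0∞) * q θ ∂μ < ∞ ∧
    ∀ᵐ θ ∂μ, (q' θ : ℝ≥0∞) = (l θ : ℝ≥0∞) * q θ / ∫⁻ θ', (l θ' : ℝ≥0∞) * q θ' ∂μ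

/-- The Bayesian update exists and is unique whenever `0 < ∫ ℓ q < ∞`. -/
theorem existsUnique_isUpdate {l : Ω → ℝ≥0} (hl : Measurable l) (q : Pdf μ)
    (h0 : 0 < ∫⁻ θ, (l θ : ℝ≥0∞) * q θ ∂μ) (h1 : ∫⁻ θ, (l θ : ℝ≥0∞) * q θ ∂μ < ∞) :
    ∃! q' : Pdf μ, IsUpdate l q q' := by
  set c : ℝ≥0∞ := ∫⁻ θ, (l θ : ℝ≥0∞) * q θ ∂μ with hc
  have hm : Measurable (fun θ => l θ * q θ / c.toNNReal) :=
    (hl.mul q.1.measurable).div_const _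
  have hc0 : c.toNNReal ≠ 0 := (ENNReal.toNNReal_pos h0.ne' h1.ne).ne'
  have hcoe : ∀ θ, ((l θ * q θ / c.toNNReal : ℝ≥0) : ℝ≥0∞) = (l θ : ℝ≥0∞) * q θ / c := by
    intro θ
    rw [ENNReal.coe_div hc0, ENNReal.coe_toNNReal h1.ne, ENNReal.coe_mul]
  have hae := AEEqFun.coeFn_mk (μ := μ) _ hm.aestronglyMeasurable
  refine ⟨⟨AEEqFun.mk _ hm.aestronglyMeasurable, ?_⟩, ⟨h0, h1, ?_⟩, ?_⟩
  · have : ∫⁻ θ, ((AEEqFun.mk _ hm.aestronglyMeasurable : Ω →ₘ[μ] ℝ≥0) θ : ℝ≥0∞) ∂μ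
        = ∫⁻ θ, (l θ : ℝ≥0∞) * q θ / c ∂μ := by
      refine lintegral_congr_ae ?_
      filter_upwards [hae] with θ hθ
      rw [hθ, hcoe]
    rw [this]
    simp only [div_eq_mul_inv]
    rw [lintegral_mul_const' _ _ (ENNReal.inv_ne_top.2 h0.ne'), ← hc]
    exact ENNReal.mul_inv_cancel h0.ne' h1.ne
  · filter_upwards [hae] with θ hθ
    rw [← hcoe]
    exact congrArg _ hθ
  · rintro q' ⟨-, -, hq'⟩
    refine Subtype.ext (AEEqFun.ext ?_)
    filter_upwards [hq', hae] with θ h2 h3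
    rw [h3]
    exact ENNReal.coe_injective (h2.trans (hcoe θ).symm)

def ExternalBayesianity (g : PoolingFunction μ K) : Prop :=
  ∀ l : Ω → ℝ≥0, Measurable l →
    ∀ q q' : Fin K → Pdf μ, IsPositiveProfile q →
      (∀ k, IsUpdate l (q k) (q' k)) → IsUpdate l (g q) (g q')

/-- The fused likelihood function `h` depends on the likelihood functions `l k` only, not on the
opinion profile. -/
def GeneralizedBayesianity (g : PoolingFunction μ K) : Prop :=
  ∀ l : Fin K → Ω → ℝ≥0,
    (∀ k, Measurable (l k) ∧ (∀ θ, 0 < l k θ) ∧ ∃ C : ℝ≥0, ∀ θ, l k θ ≤ C) →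
    ∃ h : Ω → ℝ≥0, Measurable h ∧
      ∀ q q' : Fin K → Pdf μ, IsPositiveProfile q →
        (∀ k, IsUpdate (l k) (q k) (q' k)) → IsUpdate h (g q) (g q')

end Axioms

end OpinionPooling

/-! A set of positive Lebesgue measure can be cut into disjoint events `A`, `B`, `C` of positive
measure, and mixing densities concentrated on them realizes any probabilities `x k` of `A` and `y k`
of `B` with `x k + y k ≤ 1`. Under the WSFP, additivity of the pooled probability thus becomes `H (A
∪ B) (x + y) = H A x + H B y`. The increment `H A x - H A 0` turns out not to depend on `A`, so it
solves Cauchy's equation on the cube; being bounded, it is linear. Hence `g` is affine on nontrivial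
events, with weights `w` common to all events and an offset `c A` (`WSFP.exists_isAffinePool`).

Each further axiom removes the offset, or under the SSFP it vanishes already, and then forces `w j`
to be 0 or 1 by a quadratic identity or a comparison of odds. The weights sum to one, so exactly one
equals 1, and its agent is the dictator (`IsAffinePool.isDictatorship`). -/

namespace OpinionPooling

/-! ### Densities: probabilities, mixtures, conditioning, profiles with prescribed values. -/

section Densities

variable {Ω : Type*} [MeasurableSpace Ω] {μ : Measure Ω}

/-- The probability of an event as a real number. -/
noncomputable def Pdf.realProb (q : Pdf μ) (A : Set Ω) : ℝ := (q.prob A : ℝ)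

theorem Pdf.realProb_eq (q : Pdf μ) (A : Set Ω) :
    q.realProb A = (∫⁻ θ in A, (q θ : ℝ≥0∞) ∂μ).toReal := rfl

theorem Pdf.setLIntegral_ne_top (q : Pdf μ) (A : Set Ω) :
    ∫⁻ θ in A, (q θ : ℝ≥0∞) ∂μ ≠ ∞ :=
  ((setLIntegral_le_lintegral A _).trans_lt (q.2.le.trans_lt ENNReal.one_lt_top)).ne

theorem Pdf.realProb_nonneg (q : Pdf μ) (A : Set Ω) : 0 ≤ q.realProb A := (q.prob A).2.1

theorem Pdf.realProb_le_one (q : Pdf μ) (A : Set Ω) : q.realProb A ≤ 1 := (q.prob A).2.2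

theorem Pdf.realProb_univ (q : Pdf μ) : q.realProb Set.univ = 1 := by
  rw [Pdf.realProb_eq, setLIntegral_univ, q.2, ENNReal.toReal_one]

theorem Pdf.realProb_of_null (q : Pdf μ) {A : Set Ω} (hA : μ A = 0) : q.realProb A = 0 := by
  rw [Pdf.realProb_eq, setLIntegral_measure_zero A _ hA, ENNReal.toReal_zero]

theorem Pdf.realProb_union (q : Pdf μ) {A B : Set Ω} (hB : MeasurableSet B) (h : Disjoint A B) :
    q.realProb (A ∪ B) = q.realProb A + q.realProb B := by
  rw [Pdf.realProb_eq, lintegral_union hB h,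
    ENNReal.toReal_add (q.setLIntegral_ne_top A) (q.setLIntegral_ne_top B)]
  rfl

theorem Pdf.realProb_add_compl (q : Pdf μ) {A : Set Ω} (hA : MeasurableSet A) :
    q.realProb A + q.realProb Aᶜ = 1 := by
  rw [← q.realProb_union hA.compl disjoint_compl_right, Set.union_compl_self, q.realProb_univ]

theorem Pdf.realProb_add_diff (q : Pdf μ) {A D : Set Ω} (hA : MeasurableSet A)
    (hD : MeasurableSet D) (h : D ⊆ A) :
    q.realProb A = q.realProb D + q.realProb (A \ D) := by
  rw [← q.realProb_union (hA.diff hD) Set.disjoint_sdiff_right, Set.union_sdiff_cancel h]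

theorem Pdf.ext_of_realProb [SigmaFinite μ] {q q' : Pdf μ}
    (h : ∀ A, MeasurableSet A → q.realProb A = q'.realProb A) : q = q' := by
  refine Subtype.ext (AEEqFun.ext ?_)
  have : (fun θ => (q θ : ℝ≥0∞)) =ᵐ[μ] fun θ => (q' θ : ℝ≥0∞) :=
    ae_eq_of_forall_setLIntegral_eq_of_sigmaFinite q.1.measurable.coe_nnreal_ennreal
      q'.1.measurable.coe_nnreal_ennreal fun A hA _ =>
        (ENNReal.toReal_eq_toReal_iff' (q.setLIntegral_ne_top A) (q'.setLIntegral_ne_top A)).1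
          (h A hA)
  filter_upwards [this] with θ hθ
  exact ENNReal.coe_injective hθ

theorem exists_pdf_ae_eq {f : Ω → ℝ≥0} (hf : Measurable f) (h1 : ∫⁻ θ, (f θ : ℝ≥0∞) ∂μ = 1) :
    ∃ q : Pdf μ, ∀ᵐ θ ∂μ, q θ = f θ := by
  have hae := AEEqFun.coeFn_mk (μ := μ) f hf.aestronglyMeasurable
  refine ⟨⟨AEEqFun.mk f hf.aestronglyMeasurable, ?_⟩, hae⟩
  rw [← h1]
  refine lintegral_congr_ae ?_
  filter_upwards [hae] with θ hθ
  rw [hθ]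

/-- Finite mixtures of densities. -/
theorem exists_pdf_mixture {ι : Type*} [Fintype ι] (r : ι → Pdf μ) (x : ι → ℝ≥0)
    (hx : ∑ i, x i = 1) :
    ∃ p : Pdf μ, ∀ᵐ θ ∂μ, p θ = ∑ i, x i * r i θ := by
  refine exists_pdf_ae_eq
    (Finset.measurable_sum _ fun i _ => (r i).1.measurable.const_mul (x i)) ?_
  simp only [ENNReal.ofNNReal_finsetSum, ENNReal.coe_mul]
  rw [lintegral_finsetSum _ fun i _ => ((r i).1.measurable.coe_nnreal_ennreal.const_mul _)]
  simp only [lintegral_const_mul' _ _ ENNReal.coe_ne_top, (r _).2, mul_one]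
  rw [← ENNReal.ofNNReal_finsetSum, hx, ENNReal.coe_one]

theorem setLIntegral_mixture {ι : Type*} [Fintype ι] {r : ι → Pdf μ} {x : ι → ℝ≥0} {p : Pdf μ}
    (hp : ∀ᵐ θ ∂μ, p θ = ∑ i, x i * r i θ) {l : Ω → ℝ≥0} (hl : Measurable l) (A : Set Ω) :
    ∫⁻ θ in A, (l θ : ℝ≥0∞) * p θ ∂μ
      = ∑ i, (x i : ℝ≥0∞) * ∫⁻ θ in A, (l θ : ℝ≥0∞) * r i θ ∂μ := by
  have : ∫⁻ θ in A, (l θ : ℝ≥0∞) * p θ ∂μ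
      = ∫⁻ θ in A, ∑ i, (x i : ℝ≥0∞) * ((l θ : ℝ≥0∞) * r i θ) ∂μ := by
    refine lintegral_congr_ae ?_
    filter_upwards [ae_restrict_of_ae hp] with θ hθ
    rw [hθ]
    push_cast
    rw [Finset.mul_sum]
    exact Finset.sum_congr rfl fun i _ => by ring
  have hm : ∀ i, Measurable fun θ => (x i : ℝ≥0∞) * ((l θ : ℝ≥0∞) * r i θ) := fun i =>
    (hl.coe_nnreal_ennreal.mul (r i).1.measurable.coe_nnreal_ennreal).const_mul _
  rw [this, lintegral_finsetSum _ fun i _ => hm i]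
  simp only [lintegral_const_mul' _ _ ENNReal.coe_ne_top]

theorem realProb_mixture {ι : Type*} [Fintype ι] {r : ι → Pdf μ} {x : ι → ℝ≥0} {p : Pdf μ}
    (hp : ∀ᵐ θ ∂μ, p θ = ∑ i, x i * r i θ) (A : Set Ω) :
    p.realProb A = ∑ i, (x i : ℝ) * (r i).realProb A := by
  have h := setLIntegral_mixture hp (l := fun _ => 1) measurable_const A
  simp only [ENNReal.coe_one, one_mul] at h
  rw [Pdf.realProb_eq, h, ENNReal.toReal_sum fun i _ =>
    ENNReal.mul_ne_top ENNReal.coe_ne_top ((r i).setLIntegral_ne_top A)]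
  simp [Pdf.realProb_eq]

theorem exists_pdf_pos [SigmaFinite μ] (hμ : μ ≠ 0) : ∃ r : Pdf μ, ∀ᵐ θ ∂μ, 0 < r θ := by
  obtain ⟨f, hf0, hf, hf1⟩ := exists_pos_lintegral_lt_of_sigmaFinite μ one_ne_zero
  set c := ∫⁻ θ, (f θ : ℝ≥0∞) ∂μ with hc
  have hct : c ≠ ∞ := (hf1.trans ENNReal.one_lt_top).ne
  have hc0 : c ≠ 0 := by
    intro h
    rw [hc, lintegral_eq_zero_iff hf.coe_nnreal_ennreal] at h
    refine hμ (ae_eq_bot.1 (Filter.eventually_false_iff_eq_bot.1 ?_))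
    filter_upwards [h] with θ hθ
    exact (hf0 θ).ne' (by simpa using hθ)
  have hc0' : c.toNNReal ≠ 0 := (ENNReal.toNNReal_pos hc0 hct).ne'
  obtain ⟨q, hq⟩ := exists_pdf_ae_eq (μ := μ) (hf.div_const c.toNNReal) (by
    simp only [ENNReal.coe_div hc0', ENNReal.coe_toNNReal hct]
    simp only [div_eq_mul_inv]
    rw [lintegral_mul_const' _ _ (ENNReal.inv_ne_top.2 hc0), ← hc]
    exact ENNReal.mul_inv_cancel hc0 hct)
  refine ⟨q, ?_⟩
  filter_upwards [hq] with θ hθ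
  rw [hθ]
  exact div_pos (hf0 θ) (ENNReal.toNNReal_pos hc0 hct)

theorem IsUpdate.realProb_mul {l : Ω → ℝ≥0} {q q' : Pdf μ} (h : IsUpdate l q q') (A : Set Ω) :
    q'.realProb A * (∫⁻ θ, (l θ : ℝ≥0∞) * q θ ∂μ).toReal
      = (∫⁻ θ in A, (l θ : ℝ≥0∞) * q θ ∂μ).toReal := by
  obtain ⟨h0, h1, h2⟩ := h
  rw [Pdf.realProb_eq, lintegral_congr_ae (ae_restrict_of_ae h2)]
  simp only [div_eq_mul_inv]
  rw [lintegral_mul_const' _ _ (ENNReal.inv_ne_top.2 h0.ne'), ← ENNReal.toReal_mul, mul_assoc,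
    ENNReal.inv_mul_cancel h0.ne' h1.ne, mul_one]

theorem IsUpdate.toReal_pos {l : Ω → ℝ≥0} {q q' : Pdf μ} (h : IsUpdate l q q') :
    0 < (∫⁻ θ, (l θ : ℝ≥0∞) * q θ ∂μ).toReal :=
  ENNReal.toReal_pos h.1.ne' h.2.1.ne

theorem setLIntegral_indicator_mul {A : Set Ω} (hA : MeasurableSet A) (q : Pdf μ) (B : Set Ω) :
    ∫⁻ θ in B, ((A.indicator (fun _ => (1 : ℝ≥0)) θ : ℝ≥0) : ℝ≥0∞) * q θ ∂μ
      = ∫⁻ θ in A ∩ B, (q θ : ℝ≥0∞) ∂μ := by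
  rw [← setLIntegral_indicator hA]
  refine lintegral_congr fun θ => ?_
  by_cases h : θ ∈ A <;> simp [h]

theorem lintegral_indicator_mul {A : Set Ω} (hA : MeasurableSet A) (q : Pdf μ) :
    ∫⁻ θ, ((A.indicator (fun _ => (1 : ℝ≥0)) θ : ℝ≥0) : ℝ≥0∞) * q θ ∂μ
      = ∫⁻ θ in A, (q θ : ℝ≥0∞) ∂μ := by
  rw [← setLIntegral_univ, setLIntegral_indicator_mul hA, Set.inter_univ]

/-- Conditioning on an event. -/
theorem exists_isUpdate_indicator {A : Set Ω} (hA : MeasurableSet A) (q : Pdf μ)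
    (h : 0 < q.realProb A) : ∃ q', IsUpdate (A.indicator fun _ => (1 : ℝ≥0)) q q' := by
  refine (existsUnique_isUpdate (measurable_const.indicator hA) q ?_ ?_).exists <;>
    rw [lintegral_indicator_mul hA]
  · exact (ENNReal.toReal_pos_iff.1 h).1
  · exact (q.setLIntegral_ne_top A).lt_top

theorem IsUpdate.indicator_pos {A : Set Ω} (hA : MeasurableSet A) {q q' : Pdf μ}
    (h : IsUpdate (A.indicator fun _ => (1 : ℝ≥0)) q q') : 0 < q.realProb A := by
  have := h.toReal_pos
  rwa [lintegral_indicator_mul hA] at this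

theorem IsUpdate.indicator_mul {A : Set Ω} (hA : MeasurableSet A) {q q' : Pdf μ}
    (h : IsUpdate (A.indicator fun _ => (1 : ℝ≥0)) q q') {B : Set Ω} :
    q'.realProb B * q.realProb A = q.realProb (A ∩ B) := by
  have := h.realProb_mul B
  rwa [lintegral_indicator_mul hA, setLIntegral_indicator_mul hA] at this

theorem Pdf.realProb_pos {q : Pdf μ} (hq : ∀ᵐ θ ∂μ, 0 < q θ) {A : Set Ω} (hA : μ A ≠ 0) :
    0 < q.realProb A := by
  refine ENNReal.toReal_pos (fun h => hA ?_) (q.setLIntegral_ne_top A)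
  rw [lintegral_eq_zero_iff q.1.measurable.coe_nnreal_ennreal] at h
  rw [← Measure.restrict_eq_zero]
  refine ae_eq_bot.1 (Filter.eventually_false_iff_eq_bot.1 ?_)
  filter_upwards [h, ae_restrict_of_ae hq] with θ h1 h2
  exact h2.ne' (by simpa using h1)

/-- A density that is positive exactly on a given event. -/
theorem exists_pdf_concentrated [SigmaFinite μ] {S : Set Ω} (hS : MeasurableSet S) (h : μ S ≠ 0) :
    ∃ r : Pdf μ, (∀ᵐ θ ∂μ, θ ∈ S → 0 < r θ) ∧ r.realProb S = 1 ∧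
      ∀ T, Disjoint S T → r.realProb T = 0 := by
  obtain ⟨p, hp⟩ := exists_pdf_pos (μ := μ) (by rintro rfl; simp at h)
  have hpos := p.realProb_pos hp h
  obtain ⟨r, hr⟩ := exists_isUpdate_indicator hS p hpos
  refine ⟨r, ?_, ?_, ?_⟩
  · filter_upwards [hp, hr.2.2] with θ h1 h2 h3
    rw [← ENNReal.coe_pos, h2]
    simp only [h3, Set.indicator_of_mem, ENNReal.coe_one, one_mul]
    exact ENNReal.div_pos (ENNReal.coe_pos.2 h1).ne' hr.2.1.ne
  · have := hr.indicator_mul hS (B := S)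
    rw [Set.inter_self] at this
    exact mul_right_cancel₀ hpos.ne' (by rw [this, one_mul])
  · intro T hT
    have := hr.indicator_mul hS (B := T)
    rw [Set.disjoint_iff_inter_eq_empty.1 hT, p.realProb_of_null measure_empty] at this
    exact (mul_eq_zero.1 this).resolve_right hpos.ne'

/-- Opinion profiles with prescribed probabilities of two disjoint events. -/
theorem exists_profile [SigmaFinite μ] {ι : Type*} {A B : Set Ω} (hA : MeasurableSet A)
    (hB : MeasurableSet B) (hAB : Disjoint A B) (hA0 : μ A ≠ 0) (hB0 : μ B ≠ 0)
    (hC0 : μ (A ∪ B)ᶜ ≠ 0) (x y : ι → ℝ) (hx : ∀ k, 0 ≤ x k) (hy : ∀ k, 0 ≤ y k)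
    (hxy : ∀ k, x k + y k ≤ 1) :
    ∃ q : ι → Pdf μ, (∀ k, (q k).realProb A = x k) ∧ (∀ k, (q k).realProb B = y k) ∧
      ∀ k, 0 < x k → 0 < y k → x k + y k < 1 → ∀ᵐ θ ∂μ, 0 < q k θ := by
  obtain ⟨ra, ha, ha1, ha0⟩ := exists_pdf_concentrated hA hA0
  obtain ⟨rb, hb, hb1, hb0⟩ := exists_pdf_concentrated hB hB0
  obtain ⟨rc, hc, hc1, hc0⟩ := exists_pdf_concentrated (hA.union hB).compl hC0
  have key : ∀ k, ∃ p : Pdf μ, p.realProb A = x k ∧ p.realProb B = y k ∧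
      (0 < x k → 0 < y k → x k + y k < 1 → ∀ᵐ θ ∂μ, 0 < p θ) := by
    intro k
    have hz : 0 ≤ 1 - x k - y k := by linarith [hxy k]
    -- The mass left over by `A` and `B` goes to the complement, so all three weights are positive
    -- exactly in the strict case.
    obtain ⟨p, hp⟩ := exists_pdf_mixture ![ra, rb, rc]
      ![(x k).toNNReal, (y k).toNNReal, (1 - x k - y k).toNNReal] (by
        rw [Fin.sum_univ_three]
        ext
        simp [hx k, hy k, hz])
    refine ⟨p, ?_, ?_, ?_⟩
    · rw [realProb_mixture hp, Fin.sum_univ_three]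
      simp [hx k, ha1, hb0 A hAB.symm, hc0 A (disjoint_compl_left.mono_right Set.subset_union_left)]
    · rw [realProb_mixture hp, Fin.sum_univ_three]
      simp [hy k, hb1, ha0 B hAB, hc0 B (disjoint_compl_left.mono_right Set.subset_union_right)]
    · intro h1 h2 h3
      filter_upwards [hp, ha, hb, hc] with θ h ha hb hc
      rw [h, Fin.sum_univ_three]
      simp only [Matrix.cons_val]
      have h1' := Real.toNNReal_pos.2 h1
      have h2' := Real.toNNReal_pos.2 h2
      have h3' : 0 < (1 - x k - y k).toNNReal := Real.toNNReal_pos.2 (by linarith)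
      by_cases hθa : θ ∈ A
      · have := mul_pos h1' (ha hθa)
        positivity
      · by_cases hθb : θ ∈ B
        · have := mul_pos h2' (hb hθb)
          positivity
        · have := mul_pos h3' (hc (by simp [hθa, hθb]))
          positivity
  choose q h1 h2 h3 using key
  exact ⟨q, h1, h2, h3⟩

end Densities


/-! ### Bounded solutions of Cauchy's equation on the interval and the cube. -/

/-- A bounded function on `[0,1]` that is additive is linear. -/
theorem eq_mul_of_additive_of_bounded {f : ℝ → ℝ} {C : ℝ}
    (hadd : ∀ s t, 0 ≤ s → 0 ≤ t → s + t ≤ 1 → f (s + t) = f s + f t)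
    (hbd : ∀ t, 0 ≤ t → t ≤ 1 → |f t| ≤ C) {t : ℝ} (ht0 : 0 ≤ t) (ht1 : t ≤ 1) :
    f t = t * f 1 := by
  set F : ℝ → ℝ := fun s => f s - s * f 1 with hF
  have hFadd : ∀ s t, 0 ≤ s → 0 ≤ t → s + t ≤ 1 → F (s + t) = F s + F t := by
    intro s t hs ht hst
    simp only [hF, hadd s t hs ht hst]
    ring
  have hF1 : F 1 = 0 := by simp [hF]
  have hFt : F (1 - t) = - F t := by
    have := hFadd (1 - t) t (by linarith) ht0 (by linarith)
    rw [sub_add_cancel, hF1] at this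
    linarith
  -- Since `F 1 = 0`, `F` behaves as if it were additive modulo 1. Repeated steps of length `t`
  -- around the circle reach every multiple of `F t`, which boundedness allows only if `F t = 0`.
  have key : ∀ n : ℕ, ∃ u, 0 ≤ u ∧ u ≤ 1 ∧ F u = n * F t := by
    intro n
    induction n with
    | zero => exact ⟨1, zero_le_one, le_rfl, by simp [hF1]⟩
    | succ n ih =>
      obtain ⟨u, hu0, hu1, hu⟩ := ih
      rcases le_total (u + t) 1 with h | h
      · refine ⟨u + t, by linarith, h, ?_⟩
        rw [hFadd u t hu0 ht0 h, hu]
        push_cast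
        ring
      · refine ⟨u + t - 1, by linarith, by linarith, ?_⟩
        have := hFadd (1 - t) (u + t - 1) (by linarith) (by linarith) (by linarith)
        rw [show 1 - t + (u + t - 1) = u by ring, hFt, hu] at this
        push_cast
        linarith
  have hFbd : ∀ s, 0 ≤ s → s ≤ 1 → |F s| ≤ C + |f 1| := by
    intro s hs0 hs1
    refine (abs_sub _ _).trans (add_le_add (hbd s hs0 hs1) ?_)
    rw [abs_mul, abs_of_nonneg hs0]
    exact mul_le_of_le_one_left (abs_nonneg _) hs1
  have hz : F t = 0 := by
    by_contra hne
    obtain ⟨n, hn⟩ := exists_nat_gt ((C + |f 1|) / |F t|)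
    obtain ⟨u, hu0, hu1, hu⟩ := key n
    have h1 := hFbd u hu0 hu1
    rw [hu, abs_mul, Nat.abs_cast] at h1
    rw [div_lt_iff₀ (abs_pos.2 hne)] at hn
    linarith
  simp only [hF] at hz
  linarith

/-- A bounded function on the unit cube that is additive is linear. -/
theorem eq_sum_of_additive_of_bounded {K : ℕ} {f : (Fin K → ℝ) → ℝ} {C : ℝ}
    (hadd : ∀ x y : Fin K → ℝ, (∀ k, 0 ≤ x k) → (∀ k, 0 ≤ y k) → (∀ k, x k + y k ≤ 1) →
      f (x + y) = f x + f y)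
    (hbd : ∀ x : Fin K → ℝ, (∀ k, 0 ≤ x k) → (∀ k, x k ≤ 1) → |f x| ≤ C)
    {x : Fin K → ℝ} (hx0 : ∀ k, 0 ≤ x k) (hx1 : ∀ k, x k ≤ 1) :
    f x = ∑ k, f (Pi.single k 1) * x k := by
  have hzero : f 0 = 0 := by
    have := hadd 0 0 (by simp) (by simp) (by simp)
    rw [add_zero] at this
    linarith
  have hsingle : ∀ k t, 0 ≤ t → t ≤ 1 → f (Pi.single k t) = t * f (Pi.single k 1) := by
    intro k t ht0 ht1
    have hs0 : ∀ s : ℝ, 0 ≤ s → ∀ j, 0 ≤ (Pi.single k s : Fin K → ℝ) j := by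
      intro s hs j
      rw [Pi.single_apply]
      split_ifs <;> simp [hs]
    have hs1 : ∀ s : ℝ, s ≤ 1 → ∀ j, (Pi.single k s : Fin K → ℝ) j ≤ 1 := by
      intro s hs j
      rw [Pi.single_apply]
      split_ifs <;> simp [hs]
    refine eq_mul_of_additive_of_bounded (f := fun t => f (Pi.single k t)) (C := C)
      (fun s t hs ht hst => ?_) (fun t h0 h1 => hbd _ (hs0 t h0) (hs1 t h1)) ht0 ht1
    simp only [Pi.single_add]
    refine hadd _ _ (hs0 s hs) (hs0 t ht) fun j => ?_
    rw [← Pi.add_apply, ← Pi.single_add]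
    exact hs1 _ hst j
  have key : ∀ S : Finset (Fin K),
      f (∑ k ∈ S, Pi.single k (x k)) = ∑ k ∈ S, f (Pi.single k 1) * x k := by
    intro S
    induction S using Finset.induction_on with
    | empty => simpa using hzero
    | insert a S ha ih =>
      -- The partial sum and the new term have disjoint supports, so their sum stays in the cube, as
      -- `hadd` requires.
      have hval : ∀ j, (∑ k ∈ S, (Pi.single k (x k) : Fin K → ℝ)) j = if j ∈ S then x j else 0 := by
        intro j
        simp [Finset.sum_apply, Pi.single_apply]
      rw [Finset.sum_insert ha, Finset.sum_insert ha, hadd, ih, hsingle a _ (hx0 a) (hx1 a),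
        mul_comm]
      · intro j
        rw [Pi.single_apply]
        split_ifs <;> simp [hx0]
      · intro j
        rw [hval]
        split_ifs <;> simp [hx0]
      · intro j
        rw [hval, Pi.single_apply]
        by_cases h : j = a
        · simp [h, ha, hx1]
        · simp only [h, if_false, zero_add]
          split_ifs <;> simp [hx1]
  have := key Finset.univ
  rwa [Finset.univ_sum_single] at this

/-! ### From the WSFP to an affine pool. -/

section Representation

variable {Ω : Type*} [MeasurableSpace Ω] {μ : Measure Ω} {K : ℕ}

/-- Every event of positive measure splits into two events of positive measure. -/
def Divisible (μ : Measure Ω) : Prop :=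
  ∀ A, MeasurableSet A → μ A ≠ 0 → ∃ D ⊆ A, MeasurableSet D ∧ μ D ≠ 0 ∧ μ (A \ D) ≠ 0

theorem Divisible.exists_disjoint (hμ : Divisible μ) {A : Set Ω} (hA : MeasurableSet A)
    (hA1 : μ Aᶜ ≠ 0) : ∃ B, MeasurableSet B ∧ Disjoint A B ∧ μ B ≠ 0 ∧ μ (A ∪ B)ᶜ ≠ 0 := by
  obtain ⟨B, hBA, hB, hB0, hB1⟩ := hμ _ hA.compl hA1
  refine ⟨B, hB, Set.disjoint_left.2 fun x hx hxB => hBA hxB hx, hB0, ?_⟩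
  rwa [Set.compl_union, ← Set.sdiff_eq]

/-- `g` acts on the probabilities of `A` through the function `H A` of real arguments. -/
def ActsThrough (g : PoolingFunction μ K) (H : Set Ω → (Fin K → ℝ) → ℝ) : Prop :=
  ∀ A, MeasurableSet A → ∀ q, (g q).realProb A = H A fun k => (q k).realProb A

theorem WSFP.exists_actsThrough {g : PoolingFunction μ K} (hg : WSFP g) :
    ∃ H : Set Ω → (Fin K → ℝ) → ℝ, ActsThrough g H := by
  classical
  choose h hh using hg
  -- Clamping to `[0,1]` extends the function to real arguments; the value 0 on nonmeasurable sets
  -- is arbitrary.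
  refine ⟨fun A x => if hA : MeasurableSet A then
    (h A hA fun k => Set.projIcc 0 1 zero_le_one (x k) : unitInterval) else 0, fun A hA q => ?_⟩
  simp only [hA, dif_pos, Pdf.realProb, Set.projIcc_val, hh]

variable [SigmaFinite μ] {g : PoolingFunction μ K} {H : Set Ω → (Fin K → ℝ) → ℝ}

namespace ActsThrough

theorem union_add (hH : ActsThrough g H) {A B : Set Ω} (hA : MeasurableSet A)
    (hB : MeasurableSet B) (hAB : Disjoint A B) (hA0 : μ A ≠ 0) (hB0 : μ B ≠ 0)
    (hC0 : μ (A ∪ B)ᶜ ≠ 0) {x y : Fin K → ℝ} (hx : ∀ k, 0 ≤ x k) (hy : ∀ k, 0 ≤ y k)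
    (hxy : ∀ k, x k + y k ≤ 1) : H (A ∪ B) (x + y) = H A x + H B y := by
  obtain ⟨q, hqA, hqB, -⟩ := exists_profile hA hB hAB hA0 hB0 hC0 x y hx hy hxy
  have h := (g q).realProb_union hB hAB
  rw [hH _ (hA.union hB), hH _ hA, hH _ hB] at h
  simp only [fun k => (q k).realProb_union hB hAB, hqA, hqB] at h
  exact h

/-- Taking `y = 0` in `union_add` changes `H A x` only by the constant `H B 0`. Subtracting the
value at 0 is necessary, as a constant pool shows. -/
theorem increment_eq_union (hH : ActsThrough g H) {A B : Set Ω} (hA : MeasurableSet A)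
    (hB : MeasurableSet B) (hAB : Disjoint A B) (hA0 : μ A ≠ 0) (hB0 : μ B ≠ 0)
    (hC0 : μ (A ∪ B)ᶜ ≠ 0) {x : Fin K → ℝ} (hx : ∀ k, 0 ≤ x k) (hx1 : ∀ k, x k ≤ 1) :
    H A x - H A 0 = H (A ∪ B) x - H (A ∪ B) 0 := by
  have h1 := hH.union_add hA hB hAB hA0 hB0 hC0 (x := x) (y := 0) hx (by simp) (by simpa using hx1)
  have h2 := hH.union_add hA hB hAB hA0 hB0 hC0 (x := 0) (y := 0) (by simp) (by simp) (by simp)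
  rw [add_zero] at h1 h2
  rw [h1, h2]
  ring

theorem exists_realProb_eq (hμ : Divisible μ) {A : Set Ω} (hA : MeasurableSet A) (hA0 : μ A ≠ 0)
    (hA1 : μ Aᶜ ≠ 0) {x : Fin K → ℝ} (hx : ∀ k, 0 ≤ x k) (hx1 : ∀ k, x k ≤ 1) :
    ∃ q : Fin K → Pdf μ, ∀ k, (q k).realProb A = x k := by
  obtain ⟨B, hB, hAB, hB0, hC0⟩ := hμ.exists_disjoint hA hA1
  obtain ⟨q, hq, -⟩ := exists_profile hA hB hAB hA0 hB0 hC0 x 0 hx (by simp) (by simpa using hx1)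
  exact ⟨q, hq⟩

theorem increment_eq_of_subset (hH : ActsThrough g H) (hμ : Divisible μ) {A D : Set Ω}
    (hA : MeasurableSet A) (hD : MeasurableSet D) (hDA : D ⊆ A) (hD0 : μ D ≠ 0) (hA1 : μ Aᶜ ≠ 0)
    {x : Fin K → ℝ} (hx : ∀ k, 0 ≤ x k) (hx1 : ∀ k, x k ≤ 1) :
    H D x - H D 0 = H A x - H A 0 := by
  by_cases h : μ (A \ D) = 0
  -- Every pdf gives `A` and `D` the same probability here, so the two functions agree wherever
  -- arguments are realized, which is on the whole cube.
  · have key : ∀ y : Fin K → ℝ, (∀ k, 0 ≤ y k) → (∀ k, y k ≤ 1) → H D y = H A y := by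
      intro y hy hy1
      obtain ⟨q, hq⟩ := exists_realProb_eq hμ hA (fun h0 => hD0 (measure_mono_null hDA h0)) hA1
        hy hy1
      have hp : ∀ p : Pdf μ, p.realProb D = p.realProb A := fun p => by
        rw [p.realProb_add_diff hA hD hDA, p.realProb_of_null h, add_zero]
      have := hp (g q)
      rwa [hH D hD, hH A hA, funext fun k => hp (q k), funext hq] at this
    rw [key x hx hx1, key 0 (by simp) (by simp)]
  · have hu : D ∪ A \ D = A := Set.union_sdiff_cancel hDA
    have := hH.increment_eq_union hD (hA.diff hD) Set.disjoint_sdiff_right hD0 h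
      (by rwa [hu]) hx hx1
    rwa [hu] at this

/-- If `A ∩ B` is not null, both events are compared with it. Otherwise `A` is first shrunk to `D`,
so that `A \ D` is left outside `D ∪ B \ A` and both pieces can be compared with their union. -/
theorem increment_eq (hH : ActsThrough g H) (hμ : Divisible μ) {A B : Set Ω}
    (hA : MeasurableSet A) (hB : MeasurableSet B) (hA0 : μ A ≠ 0) (hB0 : μ B ≠ 0)
    (hA1 : μ Aᶜ ≠ 0) (hB1 : μ Bᶜ ≠ 0) {x : Fin K → ℝ} (hx : ∀ k, 0 ≤ x k) (hx1 : ∀ k, x k ≤ 1) :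
    H A x - H A 0 = H B x - H B 0 := by
  by_cases h : μ (A ∩ B) = 0
  · obtain ⟨D, hDA, hD, hD0, hD1⟩ := hμ A hA hA0
    have hBA0 : μ (B \ A) ≠ 0 := by
      intro h'
      refine hB0 (measure_mono_null ?_ (measure_union_null h h'))
      intro x hx
      by_cases hxA : x ∈ A
      · exact Or.inl ⟨hxA, hx⟩
      · exact Or.inr ⟨hx, hxA⟩
    have hdisj : Disjoint D (B \ A) := Set.disjoint_sdiff_right.mono_left hDA
    have hC : μ (D ∪ B \ A)ᶜ ≠ 0 := by
      refine fun h' => hD1 (measure_mono_null ?_ h')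
      rintro x ⟨hxA, hxD⟩ (h1 | h1)
      exacts [hxD h1, h1.2 hxA]
    rw [← hH.increment_eq_of_subset hμ hA hD hDA hD0 hA1 hx hx1,
      ← hH.increment_eq_of_subset hμ hB (hB.diff hA) Set.sdiff_subset hBA0 hB1 hx hx1,
      hH.increment_eq_union hD (hB.diff hA) hdisj hD0 hBA0 hC hx hx1,
      hH.increment_eq_union (hB.diff hA) hD hdisj.symm hBA0 hD0 (by rwa [Set.union_comm]) hx hx1,
      Set.union_comm]
  · rw [← hH.increment_eq_of_subset hμ hA (hA.inter hB) Set.inter_subset_left h hA1 hx hx1,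
      ← hH.increment_eq_of_subset hμ hB (hA.inter hB) Set.inter_subset_right h hB1 hx hx1]

end ActsThrough

/-- `g` is an affine pool: on nontrivial events it is given by weights `w` and an offset `c`. -/
def IsAffinePool (g : PoolingFunction μ K) (w : Fin K → ℝ) (c : Set Ω → ℝ) : Prop :=
  ∀ A, MeasurableSet A → μ A ≠ 0 → μ Aᶜ ≠ 0 → ∀ q,
    (g q).realProb A = ∑ k, w k * (q k).realProb A + c A

theorem WSFP.exists_isAffinePool (hμ : Divisible μ) (hg : WSFP g) :
    ∃ w c, IsAffinePool g w c := by
  obtain ⟨H, hH⟩ := hg.exists_actsThrough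
  by_cases hne : ∃ A, MeasurableSet A ∧ μ A ≠ 0 ∧ μ Aᶜ ≠ 0
  swap
  -- Without nontrivial events the claim is vacuous.
  · exact ⟨0, 0, fun A hA h0 h1 => (hne ⟨A, hA, h0, h1⟩).elim⟩
  obtain ⟨A, hA, hA0, hA1⟩ := hne
  obtain ⟨B, hB, hAB, hB0, hC0⟩ := hμ.exists_disjoint hA hA1
  have hU0 : μ (A ∪ B) ≠ 0 := fun h => hA0 (measure_mono_null Set.subset_union_left h)
  have hB1 : μ Bᶜ ≠ 0 := fun h =>
    hC0 (measure_mono_null (Set.compl_subset_compl.2 Set.subset_union_right) h)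
  have hlin : ∀ x : Fin K → ℝ, (∀ k, 0 ≤ x k) → (∀ k, x k ≤ 1) →
      H A x - H A 0 = ∑ k, (H A (Pi.single k 1) - H A 0) * x k := by
    intro x hx hx1
    refine eq_sum_of_additive_of_bounded (f := fun x => H A x - H A 0) (C := 1) ?_ ?_ hx hx1
    · intro x y hx hy hxy
      have hx1 : ∀ k, x k ≤ 1 := fun k => by linarith [hxy k, hy k]
      have hy1 : ∀ k, y k ≤ 1 := fun k => by linarith [hxy k, hx k]
      have h1 := hH.union_add hA hB hAB hA0 hB0 hC0 hx hy hxy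
      have h2 := hH.union_add hA hB hAB hA0 hB0 hC0 (x := 0) (y := 0) (by simp) (by simp)
        (by simp)
      rw [add_zero] at h2
      have h3 := hH.increment_eq hμ hA hB hA0 hB0 hA1 hB1 hy hy1
      have h4 := hH.increment_eq hμ hA (hA.union hB) hA0 hU0 hA1 hC0 (x := x + y)
        (fun k => add_nonneg (hx k) (hy k)) hxy
      linarith
    · have hbd : ∀ x : Fin K → ℝ, (∀ k, 0 ≤ x k) → (∀ k, x k ≤ 1) → 0 ≤ H A x ∧ H A x ≤ 1 := by
        intro x hx hx1
        obtain ⟨q, hq⟩ := ActsThrough.exists_realProb_eq hμ hA hA0 hA1 hx hx1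
        rw [← funext hq, ← hH A hA]
        exact ⟨Pdf.realProb_nonneg _ _, Pdf.realProb_le_one _ _⟩
      intro x hx hx1
      have h1 := hbd x hx hx1
      have h2 := hbd 0 (by simp) (by simp)
      rw [abs_le]
      constructor <;> linarith
  refine ⟨fun k => H A (Pi.single k 1) - H A 0, fun E => H E 0, fun E hE hE0 hE1 q => ?_⟩
  have hq0 : ∀ k, 0 ≤ (q k).realProb E := fun k => Pdf.realProb_nonneg _ _
  have hq1 : ∀ k, (q k).realProb E ≤ 1 := fun k => Pdf.realProb_le_one _ _
  rw [hH E hE, ← hlin _ hq0 hq1, hH.increment_eq hμ hA hE hA0 hE0 hA1 hE1 hq0 hq1]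
  ring

end Representation


/-! ### Each pair of axioms forces a dictatorship. -/

section Characterization

variable {Ω : Type*} [MeasurableSpace Ω] {μ : Measure Ω} {K : ℕ}

theorem SSFP.wsfp {g : PoolingFunction μ K} (h : SSFP g) : WSFP g := by
  obtain ⟨f, hf⟩ := h
  exact fun A hA => ⟨f, fun q => hf q A hA⟩

theorem Divisible.exists_nontrivial (hμ : Divisible μ) (h0 : μ ≠ 0) :
    ∃ A, MeasurableSet A ∧ μ A ≠ 0 ∧ μ Aᶜ ≠ 0 := by
  obtain ⟨A, -, hA, hA0, hA1⟩ := hμ Set.univ MeasurableSet.univ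
    (by rwa [Ne, Measure.measure_univ_eq_zero])
  exact ⟨A, hA, hA0, by rwa [Set.compl_eq_univ_sdiff]⟩

theorem realProb_independent {g : PoolingFunction μ K} (hg : IndependencePreservation g)
    {q : Fin K → Pdf μ} {A B : Set Ω} (hA : MeasurableSet A) (hB : MeasurableSet B)
    (h : ∀ k, (q k).realProb (A ∩ B) = (q k).realProb A * (q k).realProb B) :
    (g q).realProb (A ∩ B) = (g q).realProb A * (g q).realProb B :=
  congrArg Subtype.val (hg q A B hA hB fun k => Subtype.ext (h k))

variable [SigmaFinite μ] {g : PoolingFunction μ K} {w : Fin K → ℝ} {c : Set Ω → ℝ}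

/-- All pdfs agree on null and conull events, so the events covered by `IsAffinePool` determine a
pdf. -/
theorem Pdf.eq_of_realProb_nontrivial {q q' : Pdf μ}
    (h : ∀ A, MeasurableSet A → μ A ≠ 0 → μ Aᶜ ≠ 0 → q.realProb A = q'.realProb A) : q = q' := by
  refine Pdf.ext_of_realProb fun A hA => ?_
  by_cases h0 : μ A = 0
  · rw [q.realProb_of_null h0, q'.realProb_of_null h0]
  by_cases h1 : μ Aᶜ = 0
  · have e := q.realProb_add_compl hA
    have e' := q'.realProb_add_compl hA
    rw [Pdf.realProb_of_null _ h1] at e e'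
    linarith
  exact h A hA h0 h1

namespace IsAffinePool

theorem sum_add_offset (hg : IsAffinePool g w c) (h0 : μ ≠ 0) {A : Set Ω} (hA : MeasurableSet A)
    (hA0 : μ A ≠ 0) (hA1 : μ Aᶜ ≠ 0) : ∑ k, w k + c A + c Aᶜ = 1 := by
  obtain ⟨p, -⟩ := exists_pdf_pos (μ := μ) h0
  have e := (g fun _ => p).realProb_add_compl hA
  rw [hg A hA hA0 hA1, hg Aᶜ hA.compl hA1 (by rwa [compl_compl])] at e
  have h1 : ∑ k, w k * p.realProb A + ∑ k, w k * p.realProb Aᶜ = ∑ k, w k := by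
    rw [← Finset.sum_add_distrib]
    refine Finset.sum_congr rfl fun k _ => ?_
    rw [← mul_add, p.realProb_add_compl hA, mul_one]
  linarith

theorem isDictatorship (hg : IsAffinePool g w c) (hμ : Divisible μ) (h0 : μ ≠ 0)
    (hc : ∀ A, MeasurableSet A → μ A ≠ 0 → μ Aᶜ ≠ 0 → c A = 0)
    (hw : ∀ k, w k = 0 ∨ w k = 1) : IsDictatorship g := by
  obtain ⟨A, hA, hA0, hA1⟩ := hμ.exists_nontrivial h0
  have hsum := hg.sum_add_offset h0 hA hA0 hA1
  rw [hc A hA hA0 hA1, hc Aᶜ hA.compl hA1 (by rwa [compl_compl]), add_zero, add_zero] at hsum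
  have hw0 : ∀ k, 0 ≤ w k := fun k => by rcases hw k with h | h <;> simp [h]
  obtain ⟨j, -, hj⟩ : ∃ j ∈ Finset.univ, w j ≠ 0 := by
    by_contra! h
    rw [Finset.sum_eq_zero h] at hsum
    exact zero_ne_one hsum
  have hj1 : w j = 1 := (hw j).resolve_left hj
  have hj0 : ∀ k, k ≠ j → w k = 0 := by
    intro k hk
    rw [← Finset.add_sum_erase _ _ (Finset.mem_univ j), hj1] at hsum
    exact (Finset.sum_eq_zero_iff_of_nonneg fun i _ => hw0 i).1 (by linarith) k
      (Finset.mem_erase.2 ⟨hk, Finset.mem_univ k⟩)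
  refine ⟨j, fun q => Pdf.eq_of_realProb_nontrivial fun E hE hE0 hE1 => ?_⟩
  rw [hg E hE hE0 hE1, hc E hE hE0 hE1, Finset.sum_eq_single j
    (fun k _ hk => by rw [hj0 k hk, zero_mul]) (by simp), hj1, one_mul, add_zero]

end IsAffinePool

/-- Two degenerate kinds of independence suffice: disjoint events, one of which has probability 0
for all agents, and an event independent of itself because each agent gives it probability 0 or 1.
-/
theorem IndependencePreservation.isDictatorship (hμ : Divisible μ) (h0 : μ ≠ 0)
    (hw : WSFP g) (hi : IndependencePreservation g) : IsDictatorship g := by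
  obtain ⟨w, c, hg⟩ := hw.exists_isAffinePool hμ
  have hcw : ∀ A, MeasurableSet A → μ A ≠ 0 → μ Aᶜ ≠ 0 → ∀ j, c A * w j = 0 := by
    intro A hA hA0 hA1 j
    obtain ⟨B, hB, hAB, hB0, hC0⟩ := hμ.exists_disjoint hA hA1
    have hB1 : μ Bᶜ ≠ 0 := fun h =>
      hC0 (measure_mono_null (Set.compl_subset_compl.2 Set.subset_union_right) h)
    have key : ∀ y : Fin K → ℝ, (∀ k, 0 ≤ y k) → (∀ k, y k ≤ 1) →
        c A * (∑ k, w k * y k + c B) = 0 := by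
      intro y hy hy1
      obtain ⟨q, hqA, hqB, -⟩ := exists_profile hA hB hAB hA0 hB0 hC0 0 y (by simp) hy
        (by simpa using hy1)
      have hcap : ∀ p : Pdf μ, p.realProb (A ∩ B) = 0 := fun p => by
        rw [Set.disjoint_iff_inter_eq_empty.1 hAB, p.realProb_of_null measure_empty]
      have := realProb_independent hi hA hB (q := q) fun k => by rw [hcap, hqA]; simp
      rw [hcap, hg A hA hA0 hA1, hg B hB hB0 hB1] at this
      simp only [hqA, hqB] at this
      simpa using this.symm
    have h1 := key 0 (by simp) (by simp)
    have h2 := key (Pi.single j 1)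
      (fun k => by rw [Pi.single_apply]; split_ifs <;> simp)
      (fun k => by rw [Pi.single_apply]; split_ifs <;> simp)
    simp only [Pi.single_apply, mul_ite, mul_one, mul_zero, Finset.sum_ite_eq', Finset.mem_univ,
      if_true, Pi.zero_apply, Finset.sum_const_zero, zero_add] at h1 h2
    linear_combination h2 - h1
  have hc : ∀ A, MeasurableSet A → μ A ≠ 0 → μ Aᶜ ≠ 0 → c A = 0 := by
    by_contra! hne
    obtain ⟨A, hA, hA0, hA1, hcA⟩ := hne
    have hw0 : ∀ j, w j = 0 := fun j => (mul_eq_zero.1 (hcw A hA hA0 hA1 j)).resolve_left hcA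
    -- here `g` is constant
    obtain ⟨p, -⟩ := exists_pdf_pos (μ := μ) h0
    set Q := g fun _ => p with hQ
    have hconst : ∀ q, g q = Q := fun q =>
      Pdf.eq_of_realProb_nontrivial fun E hE hE0 hE1 => by
        rw [hQ, hg E hE hE0 hE1, hg E hE hE0 hE1]
        simp [hw0]
    set S : Set Ω := {θ | 0 < Q θ} with hS
    have hSm : MeasurableSet S := measurableSet_lt measurable_const Q.1.measurable
    have hpos : ∀ E ⊆ S, MeasurableSet E → μ E ≠ 0 → 0 < Q.realProb E := by
      intro E hES hE hE0
      refine ENNReal.toReal_pos (fun h => hE0 ?_) (Q.setLIntegral_ne_top E)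
      rw [setLIntegral_eq_zero_iff hE Q.1.measurable.coe_nnreal_ennreal] at h
      refine measure_mono_null ?_ (ae_iff.1 h)
      intro θ hθ hθ'
      exact (hES hθ).ne' (by simpa using hθ' hθ)
    have hS0 : μ S ≠ 0 := by
      intro h
      have h1 : ∫⁻ θ, (Q θ : ℝ≥0∞) ∂μ = 0 := by
        rw [lintegral_eq_zero_iff Q.1.measurable.coe_nnreal_ennreal]
        have h2 : ∀ᵐ θ ∂μ, θ ∉ S := by simpa [ae_iff] using h
        filter_upwards [h2] with θ hθ
        simpa [hS] using hθ
      rw [Q.2] at h1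
      exact one_ne_zero h1
    -- `D` splits the support of `Q`, so `0 < Q(D) < 1`. If all agents give `D` probability 0, it is
    -- independent of itself, and the constant value `Q` would need `Q(D) = Q(D)²`.
    obtain ⟨D, hDS, hD, hD0, hD1⟩ := hμ S hSm hS0
    have hDc : μ Dᶜ ≠ 0 := fun h => hD1 (measure_mono_null (fun x hx => hx.2) h)
    obtain ⟨q, hq⟩ := ActsThrough.exists_realProb_eq hμ hD hD0 hDc (x := (0 : Fin K → ℝ))
      (by simp) (by simp)
    have hind := realProb_independent hi hD hD (q := q) fun k => by
      rw [Set.inter_self, hq]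
      simp
    rw [Set.inter_self, hconst] at hind
    have hD2 := hpos D hDS hD hD0
    have hD3 := hpos (S \ D) Set.sdiff_subset (hSm.diff hD) hD1
    have hD4 := Q.realProb_add_diff hSm hD hDS
    have hD5 := Q.realProb_le_one S
    nlinarith
  refine hg.isDictatorship hμ h0 hc fun j => ?_
  obtain ⟨A, hA, hA0, hA1⟩ := hμ.exists_nontrivial h0
  obtain ⟨q, hq⟩ := ActsThrough.exists_realProb_eq hμ hA hA0 hA1 (x := (Pi.single j 1 : Fin K → ℝ))
    (fun k => by rw [Pi.single_apply]; split_ifs <;> simp)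
    (fun k => by rw [Pi.single_apply]; split_ifs <;> simp)
  -- Agent `j` is certain of `A` and the others exclude it, so self-independence of `A` reads `w j =
  -- w j ^ 2`.
  have hind := realProb_independent hi hA hA (q := q) fun k => by
    rw [Set.inter_self, hq, Pi.single_apply]
    split_ifs <;> simp
  rw [Set.inter_self, hg A hA hA0 hA1, hc A hA hA0 hA1] at hind
  simp only [hq, Pi.single_apply, mul_ite, mul_one, mul_zero, Finset.sum_ite_eq', Finset.mem_univ,
    if_true, add_zero] at hind
  have : w j * (w j - 1) = 0 := by linear_combination -hind
  rcases mul_eq_zero.1 this with h | h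
  · exact Or.inl h
  · exact Or.inr (by linarith)

/-- Only conditioning on events is used. After conditioning on `A`, both the agents and the pool
give `A` probability 1, whence `∑ k, w k + c A = 1`; with `sum_add_offset` this kills the offset on
complements, hence everywhere. Conditional probabilities are ratios, and averaging preserves their
product rule only for 0-1 weights. -/
theorem ExternalBayesianity.isDictatorship (hμ : Divisible μ) (h0 : μ ≠ 0)
    (hw : WSFP g) (he : ExternalBayesianity g) : IsDictatorship g := by
  obtain ⟨w, c, hg⟩ := hw.exists_isAffinePool hμ
  have hcond : ∀ A, MeasurableSet A → μ A ≠ 0 → ∀ q : Fin K → Pdf μ, IsPositiveProfile q →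
      ∃ q' : Fin K → Pdf μ, (∀ k, IsUpdate (A.indicator fun _ => (1 : ℝ≥0)) (q k) (q' k)) ∧
        IsUpdate (A.indicator fun _ => (1 : ℝ≥0)) (g q) (g q') := by
    intro A hA hA0 q hq
    choose q' hq' using fun k => exists_isUpdate_indicator hA (q k) ((q k).realProb_pos (hq k) hA0)
    exact ⟨q', hq', he _ (measurable_const.indicator hA) q q' hq hq'⟩
  have hone : ∀ (A : Set Ω) (hA : MeasurableSet A) (p p' : Pdf μ),
      IsUpdate (A.indicator fun _ => (1 : ℝ≥0)) p p' → p'.realProb A = 1 := by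
    intro A hA p p' h
    have h1 := h.indicator_mul hA (B := A)
    rw [Set.inter_self] at h1
    exact mul_right_cancel₀ (h.indicator_pos hA).ne' (by rw [h1, one_mul])
  have hsum : ∀ A, MeasurableSet A → μ A ≠ 0 → μ Aᶜ ≠ 0 → ∑ k, w k + c A = 1 := by
    intro A hA hA0 hA1
    obtain ⟨p, hp⟩ := exists_pdf_pos (μ := μ) h0
    obtain ⟨q', hq', hgq'⟩ := hcond A hA hA0 (fun _ => p) fun _ => hp
    have := hone A hA _ _ hgq'
    rw [hg A hA hA0 hA1] at this
    simpa only [hone A hA _ _ (hq' _), mul_one] using this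
  have hc : ∀ A, MeasurableSet A → μ A ≠ 0 → μ Aᶜ ≠ 0 → c A = 0 := by
    intro A hA hA0 hA1
    have h1 := hg.sum_add_offset h0 hA hA0 hA1
    have h2 := hsum Aᶜ hA.compl hA1 (by rwa [compl_compl])
    linarith
  refine hg.isDictatorship hμ h0 hc fun j => ?_
  obtain ⟨A, hA, hA0, hA1⟩ := hμ.exists_nontrivial h0
  have hs := hsum A hA hA0 hA1
  rw [hc A hA hA0 hA1, add_zero] at hs
  obtain ⟨B, hBA, hB, hB0, hD0⟩ := hμ A hA hA0
  have hB1 : μ Bᶜ ≠ 0 := fun h => hD0 (measure_mono_null (fun x hx => hx.2) h)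
  have hu : B ∪ A \ B = A := Set.union_sdiff_cancel hBA
  -- all agents but one assign probability `1 / 2` to `A`, and `1 / 2` to `B` given `A`;
  -- the remaining one has `3 / 4` instead
  obtain ⟨q, hqB, hqD, hqpos⟩ := exists_profile (ι := Fin K) hB (hA.diff hB)
    Set.disjoint_sdiff_right hB0 hD0 (by rwa [hu])
    (fun k => if k = j then 9 / 16 else 1 / 4) (fun k => if k = j then 3 / 16 else 1 / 4)
    (fun k => by split_ifs <;> norm_num)
    (fun k => by split_ifs <;> norm_num)
    (fun k => by split_ifs <;> norm_num)
  have hqA : ∀ k, (q k).realProb A = if k = j then 3 / 4 else 1 / 2 := by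
    intro k
    rw [(q k).realProb_add_diff hA hB hBA, hqB, hqD]
    split_ifs <;> norm_num
  obtain ⟨q', hq', hgq'⟩ := hcond A hA hA0 q fun k =>
    hqpos k (by split_ifs <;> norm_num) (by split_ifs <;> norm_num) (by split_ifs <;> norm_num)
  have hq'B : ∀ k, (q' k).realProb B = if k = j then 3 / 4 else 1 / 2 := by
    intro k
    have := (hq' k).indicator_mul hA (B := B)
    rw [Set.inter_eq_self_of_subset_right hBA, hqA, hqB] at this
    split_ifs at this ⊢ <;> linarith
  have hfin := hgq'.indicator_mul hA (B := B)
  rw [Set.inter_eq_self_of_subset_right hBA, hg A hA hA0 hA1, hg B hB hB0 hB1, hg B hB hB0 hB1,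
    hc A hA hA0 hA1, hc B hB hB0 hB1] at hfin
  have hval : ∀ s t : ℝ, ∑ k, w k * (if k = j then s else t) = w j * s + (1 - w j) * t := by
    intro s t
    rw [← hs, ← Finset.add_sum_erase _ _ (Finset.mem_univ j), if_pos rfl,
      ← Finset.add_sum_erase _ w (Finset.mem_univ j), add_sub_cancel_left, Finset.sum_mul]
    congr 1
    exact Finset.sum_congr rfl fun k hk => by rw [if_neg (Finset.ne_of_mem_erase hk)]
  -- The product rule becomes `(1/2 + w j / 4)² = 1/4 + 5 * w j / 16`.
  simp only [hqA, hqB, hq'B, hval] at hfin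
  have : w j * (w j - 1) = 0 := by linear_combination 16 * hfin
  rcases mul_eq_zero.1 this with h | h
  · exact Or.inl h
  · exact Or.inr (by linarith)

/-- If all agents give `A`, `B` and `A ∪ B` probability 0, the pool gives all three the same value
`h 0`. Additivity makes it 0, and it equals the offset. -/
theorem SSFP.exists_isAffinePool (hμ : Divisible μ) (hs : SSFP g) :
    ∃ w c, IsAffinePool g w c ∧ ∀ A, MeasurableSet A → μ A ≠ 0 → μ Aᶜ ≠ 0 → c A = 0 := by
  obtain ⟨w, c, hg⟩ := hs.wsfp.exists_isAffinePool hμ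
  obtain ⟨h, hh⟩ := hs
  refine ⟨w, c, hg, fun A hA hA0 hA1 => ?_⟩
  obtain ⟨B, hB, hAB, hB0, hC0⟩ := hμ.exists_disjoint hA hA1
  obtain ⟨q, hqA, hqB, -⟩ := exists_profile (ι := Fin K) hA hB hAB hA0 hB0 hC0 0 0 (by simp)
    (by simp) (by simp)
  have hzero : ∀ E, MeasurableSet E → (∀ k, (q k).realProb E = 0) →
      (g q).realProb E = (h 0 : ℝ) := by
    intro E hE hE0
    refine congrArg Subtype.val ((hh q E hE).trans (congrArg h (funext fun k => ?_)))
    exact Subtype.ext (hE0 k)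
  have h1 := hzero A hA hqA
  have h2 := hzero B hB hqB
  have h3 := hzero (A ∪ B) (hA.union hB) fun k => by
    rw [(q k).realProb_union hB hAB, hqA, hqB]
    simp
  rw [(g q).realProb_union hB hAB] at h3
  have h4 := hg A hA hA0 hA1 q
  simp only [hqA, Pi.zero_apply, mul_zero, Finset.sum_const_zero, zero_add] at h4
  linarith

/-- The fused likelihood must multiply the odds of `A` by a factor independent of the prior. If only
agent `j` updates, the linear pool has such a factor only when `w j` is 0 or 1. -/
theorem GeneralizedBayesianity.isDictatorship (hμ : Divisible μ) (h0 : μ ≠ 0)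
    (hs : SSFP g) (hb : GeneralizedBayesianity g) : IsDictatorship g := by
  classical
  obtain ⟨w, c, hg, hc⟩ := hs.exists_isAffinePool hμ
  refine hg.isDictatorship hμ h0 hc fun j => ?_
  obtain ⟨A, hA, hA0, hA1⟩ := hμ.exists_nontrivial h0
  have hA1' : μ Aᶜᶜ ≠ 0 := by rwa [compl_compl]
  have hsum := hg.sum_add_offset h0 hA hA0 hA1
  rw [hc A hA hA0 hA1, hc Aᶜ hA.compl hA1 hA1', add_zero, add_zero] at hsum
  obtain ⟨ra, hra, ha1, ha0⟩ := exists_pdf_concentrated hA hA0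
  obtain ⟨rc, hrc, hc1, hc0⟩ := exists_pdf_concentrated hA.compl hA1
  -- agent `j` doubles the weight of `A`, the others learn nothing
  set lA : Ω → ℝ≥0 := fun θ => 1 + A.indicator (fun _ => 1) θ with hlA
  have hlAm : Measurable lA := measurable_const.add (measurable_const.indicator hA)
  have hlA2 : ∀ θ, lA θ ≤ 2 := fun θ => by
    by_cases h : θ ∈ A <;> simp [hlA, h, one_add_one_eq_two]
  set l : Fin K → Ω → ℝ≥0 := fun k => if k = j then lA else fun _ => 1 with hl
  have hlk : ∀ k, Measurable (l k) ∧ (∀ θ, 0 < l k θ) ∧ ∃ C : ℝ≥0, ∀ θ, l k θ ≤ C := by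
    intro k
    by_cases h : k = j
    · simp only [hl, h, if_true]
      exact ⟨hlAm, fun θ => add_pos_of_pos_of_nonneg one_pos zero_le, 2, hlA2⟩
    · simp only [hl, h, if_false]
      exact ⟨measurable_const, fun _ => one_pos, 1, fun _ => le_rfl⟩
  obtain ⟨h, hm, hh⟩ := hb l hlk
  -- `α` and `β` are the mean fused likelihoods on `A` and its complement. As `h`, `ra` and `rc` are
  -- fixed, they do not depend on the prior probability `x` chosen below.
  set α := ∫⁻ θ in A, (h θ : ℝ≥0∞) * ra θ ∂μ with hα
  set β := ∫⁻ θ in Aᶜ, (h θ : ℝ≥0∞) * rc θ ∂μ with hβ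
  have hvanish : ∀ (r : Pdf μ) (E : Set Ω), r.realProb E = 0 →
      ∫⁻ θ in E, (h θ : ℝ≥0∞) * r θ ∂μ = 0 := by
    intro r E hE
    have h1 := (ENNReal.toReal_eq_zero_iff _).1 hE
    rcases h1 with h1 | h1
    · rw [lintegral_eq_zero_iff r.1.measurable.coe_nnreal_ennreal] at h1
      have hmr : Measurable fun θ => (h θ : ℝ≥0∞) * r θ :=
        hm.coe_nnreal_ennreal.mul r.1.measurable.coe_nnreal_ennreal
      rw [lintegral_eq_zero_iff hmr]
      filter_upwards [h1] with θ hθ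
      simp only [Pi.zero_apply] at hθ ⊢
      rw [hθ, mul_zero]
    · exact (r.setLIntegral_ne_top E h1).elim
  -- All agents share the prior `x * ra + (1 - x) * rc`, which `g` preserves. The equation compares
  -- the odds of `A` in the fused update with those in the pool of the individual updates, where
  -- agent `j` has `2 * x / (1 + x)` and the others keep `x`.
  have key : ∀ x : ℝ, 0 < x → x < 1 → 0 < x * α.toReal + (1 - x) * β.toReal ∧
      α.toReal * ((1 - w j) * (1 + x) + w j) = β.toReal * ((1 - w j) * (1 + x) + 2 * w j) := by
    intro x hx0 hx1
    obtain ⟨p, hp⟩ := exists_pdf_mixture ![ra, rc] ![x.toNNReal, (1 - x).toNNReal] (by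
      rw [Fin.sum_univ_two]
      ext
      simp [hx0.le, hx1.le])
    have hppos : ∀ᵐ θ ∂μ, 0 < p θ := by
      filter_upwards [hp, hra, hrc] with θ e h1 h2
      rw [e, Fin.sum_univ_two]
      simp only [Matrix.cons_val]
      by_cases hθ : θ ∈ A
      · have := mul_pos (Real.toNNReal_pos.2 hx0) (h1 hθ)
        positivity
      · have := mul_pos (Real.toNNReal_pos.2 (sub_pos.2 hx1)) (h2 hθ)
        positivity
    have hpA : p.realProb A = x := by
      rw [realProb_mixture hp, Fin.sum_univ_two]
      simp [hx0.le, ha1, hc0 A disjoint_compl_left]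
    have hpAc : p.realProb Aᶜ = 1 - x := by linarith [p.realProb_add_compl hA]
    have hgp : g (fun _ => p) = p := Pdf.eq_of_realProb_nontrivial fun E hE hE0 hE1 => by
      rw [hg E hE hE0 hE1, hc E hE hE0 hE1, ← Finset.sum_mul, hsum, one_mul, add_zero]
    have hq' : ∀ k, ∃ q', IsUpdate (l k) p q' := by
      intro k
      refine (existsUnique_isUpdate (hlk k).1 p ?_ ?_).exists
      · have hmp : Measurable fun θ => (l k θ : ℝ≥0∞) * p θ :=
          (hlk k).1.coe_nnreal_ennreal.mul p.1.measurable.coe_nnreal_ennreal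
        rw [pos_iff_ne_zero, Ne, lintegral_eq_zero_iff hmp]
        intro e
        refine h0 (ae_eq_bot.1 (Filter.eventually_false_iff_eq_bot.1 ?_))
        filter_upwards [e, hppos] with θ h1 h2
        have h3 := mul_pos ((hlk k).2.1 θ) h2
        refine h3.ne' ?_
        rw [← ENNReal.coe_inj, ENNReal.coe_mul]
        exact h1
      · obtain ⟨C, hC⟩ := (hlk k).2.2
        refine (lintegral_mono (g := fun θ => (C : ℝ≥0∞) * p θ) fun θ => ?_).trans_lt ?_
        · exact mul_le_mul_left (ENNReal.coe_le_coe.2 (hC θ)) _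
        · rw [lintegral_const_mul' _ _ ENNReal.coe_ne_top, p.2, mul_one]
          exact ENNReal.coe_lt_top
    choose q' hq' using hq'
    have hup := hh (fun _ => p) q' (fun _ => hppos) hq'
    rw [hgp] at hup
    have hone : ∀ k, k ≠ j → (q' k).realProb A = x := by
      intro k hk
      have := (hq' k).realProb_mul A
      simp only [hl, hk, if_false, ENNReal.coe_one, one_mul, p.2, ENNReal.toReal_one, mul_one]
        at this
      rw [this, ← hpA]
      rfl
    have hlint : ∀ E, (∫⁻ θ in E, (lA θ : ℝ≥0∞) * p θ ∂μ).toReal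
        = p.realProb E + p.realProb (A ∩ E) := by
      intro E
      simp only [hlA, ENNReal.coe_add, ENNReal.coe_one, add_mul, one_mul]
      rw [lintegral_add_left p.1.measurable.coe_nnreal_ennreal, setLIntegral_indicator_mul hA,
        ENNReal.toReal_add (p.setLIntegral_ne_top _) (p.setLIntegral_ne_top _)]
      rfl
    have hj : (q' j).realProb A * (1 + x) = 2 * x := by
      have := (hq' j).realProb_mul A
      simp only [hl, if_true] at this
      rw [← setLIntegral_univ, hlint, hlint, p.realProb_univ, Set.inter_univ, Set.inter_self,
        hpA] at this
      linarith
    have hQ : (g q').realProb A = w j * (q' j).realProb A + (1 - w j) * x := by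
      rw [hg A hA hA0 hA1, hc A hA hA0 hA1, add_zero, ← hsum,
        ← Finset.add_sum_erase _ _ (Finset.mem_univ j),
        ← Finset.add_sum_erase _ w (Finset.mem_univ j), add_sub_cancel_left, Finset.sum_mul]
      congr 1
      exact Finset.sum_congr rfl fun k hk => by rw [hone k (Finset.ne_of_mem_erase hk)]
    have hIA : (∫⁻ θ in A, (h θ : ℝ≥0∞) * p θ ∂μ).toReal = x * α.toReal := by
      rw [setLIntegral_mixture hp hm, Fin.sum_univ_two]
      simp only [Matrix.cons_val]
      rw [hvanish rc A (hc0 A disjoint_compl_left), mul_zero, add_zero, ENNReal.toReal_mul]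
      simp [hα, hx0.le]
    have hIAc : (∫⁻ θ in Aᶜ, (h θ : ℝ≥0∞) * p θ ∂μ).toReal = (1 - x) * β.toReal := by
      rw [setLIntegral_mixture hp hm, Fin.sum_univ_two]
      simp only [Matrix.cons_val]
      rw [hvanish ra Aᶜ (ha0 _ disjoint_compl_right), mul_zero, zero_add, ENNReal.toReal_mul]
      simp [hβ, hx1.le]
    have e1 := hup.realProb_mul A
    have e2 := hup.realProb_mul Aᶜ
    have e3 := hup.toReal_pos
    have e4 := (g q').realProb_add_compl hA
    set Z := (∫⁻ θ, (h θ : ℝ≥0∞) * p θ ∂μ).toReal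
    rw [hIA] at e1
    rw [hIAc] at e2
    have hZ : x * α.toReal + (1 - x) * β.toReal = Z := by
      rw [← e1, ← e2, ← add_mul, e4, one_mul]
    refine ⟨by rw [hZ]; exact e3, ?_⟩
    set y := (q' j).realProb A
    set P := (g q').realProb A
    have e5 : (g q').realProb Aᶜ = 1 - P := by linarith
    rw [e5] at e2
    have hP : P * (1 + x) = x * ((1 - w j) * (1 + x) + 2 * w j) := by
      rw [hQ]
      linear_combination w j * hj
    have hPc : (1 - P) * (1 + x) = (1 - x) * ((1 - w j) * (1 + x) + w j) := by
      linear_combination -hP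
    have hne : x * (1 - x) ≠ 0 := (mul_pos hx0 (sub_pos.2 hx1)).ne'
    -- Eliminating the normalizing constant `Z` from `e1` and `e2` gives the odds equation times `x
    -- * (1 - x)`.
    refine mul_left_cancel₀ hne ?_
    linear_combination (-(1 + x) * (1 - P)) * e1 + (1 + x) * P * e2
      - x * α.toReal * hPc + (1 - x) * β.toReal * hP
  -- The equation is affine in `x`, so any two values isolate its slope `(α - β) * (1 - w j) = 0`.
  obtain ⟨k1, k2⟩ := key (1 / 2) (by norm_num) (by norm_num)
  obtain ⟨-, k3⟩ := key (1 / 4) (by norm_num) (by norm_num)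
  have hab : (α.toReal - β.toReal) * (1 - w j) = 0 := by linear_combination 4 * k2 - 4 * k3
  rcases mul_eq_zero.1 hab with e | e
  · left
    have e' : α.toReal = β.toReal := by linarith
    rw [e'] at k1 k2
    have hβ0 : β.toReal ≠ 0 := by
      intro h
      rw [h] at k1
      norm_num at k1
    exact (mul_eq_zero.1 (show β.toReal * w j = 0 by linear_combination -k2)).resolve_left hβ0
  · exact Or.inr (by linarith)

end Characterization

/-! ### Dictatorships satisfy the axioms. -/

section Dictatorship

variable {Ω : Type*} [MeasurableSpace Ω] {μ : Measure Ω} {K : ℕ} {g : PoolingFunction μ K}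

theorem IsDictatorship.zeroPreservation (hg : IsDictatorship g) : ZeroPreservation g := by
  obtain ⟨k, hk⟩ := hg
  intro q A _ h
  rw [hk, h k]

theorem IsDictatorship.unanimityPreservation (hg : IsDictatorship g) :
    UnanimityPreservation g := by
  obtain ⟨k, hk⟩ := hg
  intro q q₀ h
  rw [hk, h k]

theorem IsDictatorship.ssfp (hg : IsDictatorship g) : SSFP g := by
  obtain ⟨k, hk⟩ := hg
  exact ⟨fun x => x k, fun q A _ => by rw [hk]⟩

theorem IsDictatorship.likelihoodPrinciple (hg : IsDictatorship g) : LikelihoodPrinciple g := by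
  obtain ⟨k, hk⟩ := hg
  refine ⟨fun x => x k, fun q => Filter.Eventually.of_forall fun θ => ?_⟩
  rw [hk, (q k).2, div_one]

theorem LikelihoodPrinciple.weakLikelihoodPrinciple (hg : LikelihoodPrinciple g) :
    WeakLikelihoodPrinciple g := by
  obtain ⟨h, hh⟩ := hg
  exact ⟨fun _ => h, hh⟩

theorem IsDictatorship.independencePreservation (hg : IsDictatorship g) :
    IndependencePreservation g := by
  obtain ⟨k, hk⟩ := hg
  intro q A B _ _ h
  rw [hk, h k]

theorem IsDictatorship.factorizationPreservation (hg : IsDictatorship g) :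
    FactorizationPreservation g := by
  obtain ⟨k, hk⟩ := hg
  intro d₁ d₂ f₁ f₂ q h
  rw [hk]
  exact h k

theorem IsDictatorship.externalBayesianity (hg : IsDictatorship g) : ExternalBayesianity g := by
  obtain ⟨k, hk⟩ := hg
  intro l _ q q' _ h
  rw [hk, hk]
  exact h k

theorem IsDictatorship.generalizedBayesianity (hg : IsDictatorship g) :
    GeneralizedBayesianity g := by
  obtain ⟨k, hk⟩ := hg
  intro l hl
  refine ⟨l k, (hl k).1, fun q q' _ h => ?_⟩
  rw [hk, hk]
  exact h k

end Dictatorship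

/-! ### Divisibility of Lebesgue measure on `Θ`, and assembly. -/

theorem divisible_of_nullSingletonClass {X : Type*} [MeasurableSpace X] [MetricSpace X]
    [OpensMeasurableSpace X] [SecondCountableTopology X] (μ : Measure X) [NullSingletonClass μ] :
    Divisible μ := by
  intro A hA hA0
  -- Every ball around `x` meets `A` in positive measure. The sets left after removing shrinking
  -- balls exhaust `A` up to the null point `x`, so one of them is not null.
  obtain ⟨x, -, hx⟩ := exists_mem_forall_mem_nhdsWithin_pos_measure hA0
  have hex : ∃ n : ℕ, μ (A \ Metric.ball x (1 / (n + 1))) ≠ 0 := by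
    by_contra! h
    refine hA0 (measure_mono_null ?_ (measure_union_null (measure_iUnion_null h)
      (measure_singleton x)))
    intro y hy
    by_cases hyx : y = x
    · exact Or.inr hyx
    · obtain ⟨n, hn⟩ := exists_nat_one_div_lt (dist_pos.2 hyx)
      exact Or.inl (Set.mem_iUnion.2 ⟨n, hy, fun hb => (Metric.mem_ball.1 hb).not_gt hn⟩)
  obtain ⟨n, hn⟩ := hex
  refine ⟨A ∩ Metric.ball x (1 / (n + 1)), Set.inter_subset_left, hA.inter measurableSet_ball,
    (hx _ (inter_mem_nhdsWithin A (Metric.ball_mem_nhds x (by positivity)))).ne', ?_⟩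
  rwa [Set.sdiff_self_inter]

theorem nullSingletonClass_comap_subtype {X : Type*} [MeasurableSpace X] {S : Set X}
    (hS : MeasurableSet S) (μ : Measure X) [NullSingletonClass μ] :
    NullSingletonClass (Measure.comap (Subtype.val : S → X) μ) := by
  refine ⟨fun x => ?_⟩
  rw [(MeasurableEmbedding.subtype_coe hS).comap_apply, Set.image_singleton, measure_singleton]

end OpinionPooling

theorem mainTheorem3 {d K : ℕ} (hd : 0 < d) (hK : 0 < K)
    {Θ : Set (EuclideanSpace ℝ (Fin d))} (hΘ : MeasurableSet Θ) (hΘ0 : volume Θ ≠ 0)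
    (g : OpinionPooling.PoolingFunction (Measure.comap (Subtype.val : Θ → EuclideanSpace ℝ (Fin d)) volume) K) :
    (OpinionPooling.IsDictatorship g →
      OpinionPooling.ZeroPreservation g ∧
      OpinionPooling.UnanimityPreservation g ∧
      OpinionPooling.SSFP g ∧
      OpinionPooling.WSFP g ∧
      OpinionPooling.LikelihoodPrinciple g ∧
      OpinionPooling.WeakLikelihoodPrinciple g ∧
      OpinionPooling.IndependencePreservation g ∧
      OpinionPooling.FactorizationPreservation g ∧
      OpinionPooling.ExternalBayesianity g ∧
      OpinionPooling.GeneralizedBayesianity g) ∧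
    List.TFAE [
      OpinionPooling.IsDictatorship g,
      OpinionPooling.SSFP g ∧ OpinionPooling.IndependencePreservation g,
      OpinionPooling.WSFP g ∧ OpinionPooling.IndependencePreservation g,
      OpinionPooling.SSFP g ∧ OpinionPooling.ExternalBayesianity g,
      OpinionPooling.WSFP g ∧ OpinionPooling.ExternalBayesianity g,
      OpinionPooling.SSFP g ∧ OpinionPooling.GeneralizedBayesianity g] := by
  refine ⟨fun h => ⟨h.zeroPreservation, h.unanimityPreservation, h.ssfp, h.ssfp.wsfp,
    h.likelihoodPrinciple, h.likelihoodPrinciple.weakLikelihoodPrinciple,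
    h.independencePreservation, h.factorizationPreservation, h.externalBayesianity,
    h.generalizedBayesianity⟩, ?_⟩
  have : Nonempty (Fin d) := ⟨⟨0, hd⟩⟩
  have := OpinionPooling.nullSingletonClass_comap_subtype hΘ (volume : Measure (EuclideanSpace ℝ (Fin d)))
  have : SigmaFinite (Measure.comap (Subtype.val : Θ → EuclideanSpace ℝ (Fin d)) volume) :=
    SigmaFinite.of_map _ measurable_subtype_coe.aemeasurable
      (by rw [map_comap_subtype_coe hΘ]; infer_instance)
  have hμ := OpinionPooling.divisible_of_nullSingletonClass
    (Measure.comap (Subtype.val : Θ → EuclideanSpace ℝ (Fin d)) volume)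
  have h0 : Measure.comap (Subtype.val : Θ → EuclideanSpace ℝ (Fin d)) volume ≠ 0 := by
    intro h
    have h1 := (MeasurableEmbedding.subtype_coe hΘ).comap_apply volume Set.univ
    rw [h, Set.image_univ, Subtype.range_coe] at h1
    exact hΘ0 h1.symm
  tfae_have 1 → 2 := fun h => ⟨h.ssfp, h.independencePreservation⟩
  tfae_have 2 → 3 := fun h => ⟨h.1.wsfp, h.2⟩
  tfae_have 3 → 1 := fun h => h.2.isDictatorship hμ h0 h.1
  tfae_have 1 → 4 := fun h => ⟨h.ssfp, h.externalBayesianity⟩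
  tfae_have 4 → 5 := fun h => ⟨h.1.wsfp, h.2⟩
  tfae_have 5 → 1 := fun h => h.2.isDictatorship hμ h0 h.1
  tfae_have 1 → 6 := fun h => ⟨h.ssfp, h.generalizedBayesianity⟩
  tfae_have 6 → 1 := fun h => h.2.isDictatorship hμ h0 h.1
  tfae_finish
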